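/- **Setting.** Consider a line network with nodes $1,\dots,n$, $n\ge 4$, where $1$ is the source and $n$ the final leaf. Line $(i,i+1)$ has resistance $r_{i,i+1}>0$, reactance $x_{i,i+1}\in\mathbb R$ and thermal rating $I^{\rm rated}_{i,i+1}$. At step $t$, node $j\ge 2$ has active and reactive loads $p_{L_j}^{(t)},q_{L_j}^{(t)}$ and a DER of rating $S_j$ with known active output $0\le p_{D_j}^{(t)}\le S_j$. Write $v_j^{(t)}$ for the squared voltage of node $j$ at step $t$; $P_{ij}^{(t)},Q_{ij}^{(t)},l_{ij}^{(t)}$ for the active flow, the reactive flow and the squared current on line $(i,j)$; and $q_{D_j}^{(t)}$ for the reactive DER output. **Algorithm.** The source voltage is constant, with $v_1\in[0.95^2,1.05^2]$, and the initial voltages $v_j^{(0)}$ are positive. At every step $t\ge1$ each node $j=i+1$ ($1\le i\le n-1$) receives $v_i^{(t-1)}$ from its parent and the flow $P^{(t-1)}_{j,j+1},Q^{(t-1)}_{j,j+1}$ to its child (both $0$ if $j=n$), and solves to first order the sub-problem (P1) in $z=(P_{ij},Q_{ij},v_j,l_{ij},q_{D_j})$: $$\min\ r_{ij}l_{ij}\quad\text{s.t.}\quad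 P_{ij}-r_{ij}l_{ij}-p_{L_j}^{(t)}+p_{D_j}^{(t)}=P_{j,j+1}^{(t-1)},\qquad Q_{ij}-x_{ij}l_{ij}-q_{L_j}^{(t)}+q_{D_j}=Q_{j,j+1}^{(t-1)},$$ $$v_j=v_i^{(t-1)}-2(r_{ij}P_{ij}+x_{ij}Q_{ij})+(r_{ij}^2+x_{ij}^2)l_{ij},\qquad l_{ij}=\frac{P_{ij}^2+Q_{ij}^2}{v_i^{(t-1)}},$$ $$0.95^2\le v_j\le 1.05^2,\qquad |q_{D_j}|\le\sqrt{S_j^2-(p_{D_j}^{(t)})^2},\qquad l_{ij}\le (I^{\rm rated}_{ij})^2 .$$ That is, its new local variables are a feasible point at which the objective does not decrease to first order along any tangent direction of the feasible set; every minimizer, and every feasible point with Karush–Kuhn–Tucker multipliers, is such a point. **Convergence.** Node $j$ has *converged* at step $t\ge 1$ if $v_j^{(t)}=v_j^{(t-1)}$. The local subsystem $\{i,i+1,i+2\}$ is *convergent* at step $t\ge 1$ if node $i+1$ has converged at step $t$ and the algorithm's values are strict local minima of the sub-problems (P1) of node $i+1$ at steps $t$ and $t+1$ and of node $i+2$ at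 step $t$. **Theorem.** Let $t_1\ge 1$ and $t_{i+1}\ge t_i+1$ for $1\le i\le n-3$. Assume that convergence is preserved: for $1\le i\le n-3$, if the subsystem $\{i,i+1,i+2\}$ is convergent at step $t_i$, then node $i+1$ has converged at every step $s\ge t_i+1$. Suppose that for every $i=1,\dots,n-2$ the condition $$\tfrac1\Delta\, v_{i+1}^{(t_i-1)}\le v_{i+1}^{(t_i)}\le\Delta\, v_{i+1}^{(t_i-1)}$$ holds with $\Delta=1$, and, with $v=v_i^{(t_i-1)}$, $w=v_{i+1}^{(t_i-1)}$, $r=r_{i,i+1}$, $x=x_{i,i+1}$, $P=P_{i,i+1}^{(t_i)}$, $Q=Q_{i,i+1}^{(t_i)}$, $P'=P_{i,i+1}^{(t_i+1)}$, $\hat r=r_{i+1,i+2}$, $\hat P=P_{i+1,i+2}^{(t_i)}$, $$\begin{aligned} &x-r\ge0, && vw-4P'rw-4\hat P\hat r v\ge0,\\ &vw-4Prw-4\hat P\hat r v\ge0, && v-4P'r-4Pr\ge0,\\ &v-4P'r-2Pr-2Px\ge0, && v-4Pr-4Px\ge0,\\ &v-P'r-\hat P\hat r\ge0, && vw-4\hat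 P\hat rv-2Prw-2Pxw\ge0,\\ &w^3-4P'rvw-2\hat P\hat rv-4P'r\ge0, && v-8Pr\ge0,\\ &v-8Qx\ge0, && v-8\hat P\hat r\ge0 . \end{aligned}$$ Then the line converges globally: for every $i=1,\dots,n-2$ the subsystem $\{i,i+1,i+2\}$ is convergent at step $t_i$; the voltage of node $i+1$ satisfies $v_{i+1}^{(s)}=v_{i+1}^{(t_i)}$ for all $t_i\le s\le t_{n-2}$; and at step $t_{n-2}$ all the controllable nodes $2,\dots,n-1$ have converged simultaneously. -/

import Mathlib

open Set Filter Topology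

/-- A line network with nodes `1, …, n`: node `1` is the source, node `n` the final leaf, and
line `i` joins node `i` to node `i + 1`.  Values at indices outside the network are irrelevant. -/
structure LineNetwork where
  /-- number of nodes -/
  n : ℕ
  /-- resistance of line `(i, i+1)` -/
  r : ℕ → ℝ
  /-- reactance of line `(i, i+1)` -/
  x : ℕ → ℝ
  /-- active load at node `j`, step `t` -/
  pL : ℕ → ℕ → ℝ
  /-- reactive load at node `j`, step `t` -/
  qL : ℕ → ℕ → ℝ
  /-- (known) active power output of the DER at node `j`, step `t` -/
  pD : ℕ → ℕ → ℝ
  /-- kVA rating of the DER at node `j` -/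
  S : ℕ → ℝ
  /-- thermal rating of line `(i, i+1)` -/
  Irated : ℕ → ℝ
  r_pos : ∀ i, 1 ≤ i → i + 1 ≤ n → 0 < r i
  pD_nonneg : ∀ j t, 2 ≤ j → j ≤ n → 0 ≤ pD j t
  pD_le : ∀ j t, 2 ≤ j → j ≤ n → pD j t ≤ S j

/-- Values of the power flow variables over the iteration steps `0, 1, 2, …`
(`0` is the initialization). -/
structure Trajectory where
  /-- squared voltage magnitude at node `j`, step `t` -/
  v : ℕ → ℕ → ℝ
  /-- sending-end active power on line `(i, i+1)`, step `t` -/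
  P : ℕ → ℕ → ℝ
  /-- sending-end reactive power on line `(i, i+1)`, step `t` -/
  Q : ℕ → ℕ → ℝ
  /-- squared current magnitude on line `(i, i+1)`, step `t` -/
  l : ℕ → ℕ → ℝ
  /-- reactive power output of the DER at node `j`, step `t` -/
  qD : ℕ → ℕ → ℝ

/-- Lower bound `0.95²` on squared voltage magnitudes (per unit). -/
noncomputable def vLow : ℝ := (0.95 : ℝ) ^ 2

/-- Upper bound `1.05²` on squared voltage magnitudes (per unit). -/
noncomputable def vHigh : ℝ := (1.05 : ℝ) ^ 2

/-- Data of the optimal power flow sub-problem (P1) of one node `j` with parent `i` in one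
iteration step. -/
structure SubproblemData where
  /-- resistance of the line `(i, j)` -/
  r : ℝ
  /-- reactance of the line `(i, j)` -/
  x : ℝ
  /-- squared voltage received from the parent node -/
  vPar : ℝ
  /-- active power flow received from the child node -/
  PCh : ℝ
  /-- reactive power flow received from the child node -/
  QCh : ℝ
  pL : ℝ
  qL : ℝ
  pD : ℝ
  S : ℝ
  Irated : ℝ

namespace SubproblemData

/-- The vector of local variables `(P_ij, Q_ij, v_j, l_ij, q_Dj)`. -/
def vec (P Q v l q : ℝ) : Fin 5 → ℝ := ![P, Q, v, l, q]

/-- Feasible set of (P1): four equality and five inequality constraints on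
`z = (P_ij, Q_ij, v_j, l_ij, q_Dj)`. -/
noncomputable def feasible (D : SubproblemData) : Set (Fin 5 → ℝ) :=
  {z | z 0 - D.r * z 3 - D.pL + D.pD = D.PCh ∧
    z 1 - D.x * z 3 - D.qL + z 4 = D.QCh ∧
    z 2 = D.vPar - 2 * (D.r * z 0 + D.x * z 1) + (D.r ^ 2 + D.x ^ 2) * z 3 ∧
    z 3 = ((z 0) ^ 2 + (z 1) ^ 2) / D.vPar ∧
    vLow ≤ z 2 ∧ z 2 ≤ vHigh ∧
    -Real.sqrt (D.S ^ 2 - D.pD ^ 2) ≤ z 4 ∧ z 4 ≤ Real.sqrt (D.S ^ 2 - D.pD ^ 2) ∧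
    z 3 ≤ D.Irated ^ 2}

/-- Objective of (P1): active power loss `r_ij l_ij` on the line. -/
def objective (D : SubproblemData) (z : Fin 5 → ℝ) : ℝ := D.r * z 3

/-- `z` is a first-order stationary point of (P1): it is feasible and the (linear) objective
does not decrease to first order along any tangent direction of the feasible set at `z`.
Every local or global minimizer of (P1), and every feasible point that admits Lagrange
multipliers (a Karush–Kuhn–Tucker point), is of this kind. -/
def IsStationary (D : SubproblemData) (z : Fin 5 → ℝ) : Prop :=
  z ∈ D.feasible ∧ ∀ d ∈ posTangentConeAt D.feasible z, 0 ≤ D.objective d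

/-- `z` is a strict local minimum of (P1). -/
def IsStrictLocalMin (D : SubproblemData) (z : Fin 5 → ℝ) : Prop :=
  z ∈ D.feasible ∧
    ∀ᶠ y in 𝓝 z, y ∈ D.feasible → y ≠ z → D.objective z < D.objective y

end SubproblemData

/-- The local variables of node `i + 1` at step `t`:
`(P_{i,i+1}, Q_{i,i+1}, v_{i+1}, l_{i,i+1}, q_{D,i+1})`. -/
def Trajectory.local (T : Trajectory) (i t : ℕ) : Fin 5 → ℝ :=
  SubproblemData.vec (T.P i t) (T.Q i t) (T.v (i + 1) t) (T.l i t) (T.qD (i + 1) t)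

/-- The sub-problem (P1) that node `i + 1` solves in step `t` (for `t ≥ 1`): the parent voltage and
the flow to the child are those received at the end of step `t - 1`; the leaf `n` has no child. -/
noncomputable def LineNetwork.subproblem (N : LineNetwork) (T : Trajectory) (i t : ℕ) :
    SubproblemData where
  r := N.r i
  x := N.x i
  vPar := T.v i (t - 1)
  PCh := if i + 1 < N.n then T.P (i + 1) (t - 1) else 0
  QCh := if i + 1 < N.n then T.Q (i + 1) (t - 1) else 0
  pL := N.pL (i + 1) t
  qL := N.qL (i + 1) t
  pD := N.pD (i + 1) t
  S := N.S (i + 1)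
  Irated := N.Irated i

/-- `T` is a run of the distributed algorithm on the line network `N`: the source voltage is fixed
and within the bounds, the initial voltages are positive, and in every step `t ≥ 1` all
nodes `2, …, n` update in parallel by solving (to first order) their sub-problems. -/
structure LineNetwork.IsRun (N : LineNetwork) (T : Trajectory) : Prop where
  source_fixed : ∀ t, T.v 1 t = T.v 1 0
  source_bounds : vLow ≤ T.v 1 0 ∧ T.v 1 0 ≤ vHigh
  init_pos : ∀ j, 2 ≤ j → j ≤ N.n → 0 < T.v j 0
  step : ∀ i t, 1 ≤ i → i + 1 ≤ N.n → 1 ≤ t →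
    (N.subproblem T i t).IsStationary (T.local i t)

/-- The `Δ`-condition on the voltage of node `j` at step `t`. -/
def DeltaCondition (T : Trajectory) (Δ : ℝ) (j t : ℕ) : Prop :=
  1 / Δ * T.v j (t - 1) ≤ T.v j t ∧ T.v j t ≤ Δ * T.v j (t - 1)

/-- Node `j` has converged at step `t`: its voltage passes the stopping test. -/
def NodeConverged (T : Trajectory) (j t : ℕ) : Prop := T.v j t = T.v j (t - 1)

/-- The twelve inequalities on the local subsystem `{i, i+1, i+2}` at step `t`. -/
def LineNetwork.SubsystemInequalities (N : LineNetwork) (T : Trajectory) (i t : ℕ) : Prop :=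
  -- `v`, `w`: voltages of nodes `i`, `i + 1` at step `t - 1`
  let v := T.v i (t - 1)
  let w := T.v (i + 1) (t - 1)
  -- first line `(i, i+1)`, at step `t` and (active flow only) at step `t + 1`
  let r := N.r i
  let x := N.x i
  let P := T.P i t
  let Q := T.Q i t
  let P' := T.P i (t + 1)
  -- second line `(i+1, i+2)`, at step `t`
  let r₂ := N.r (i + 1)
  let P₂ := T.P (i + 1) t
  0 ≤ x - r ∧
  0 ≤ v * w - 4 * P' * r * w - 4 * P₂ * r₂ * v ∧
  0 ≤ v * w - 4 * P * r * w - 4 * P₂ * r₂ * v ∧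
  0 ≤ v - 4 * P' * r - 4 * P * r ∧
  0 ≤ v - 4 * P' * r - 2 * P * r - 2 * P * x ∧
  0 ≤ v - 4 * P * r - 4 * P * x ∧
  0 ≤ v - P' * r - P₂ * r₂ ∧
  0 ≤ v * w - 4 * P₂ * r₂ * v - 2 * P * r * w - 2 * P * x * w ∧
  0 ≤ w ^ 3 - 4 * P' * r * v * w - 2 * P₂ * r₂ * v - 4 * P' * r ∧
  0 ≤ v - 8 * P * r ∧
  0 ≤ v - 8 * Q * x ∧
  0 ≤ v - 8 * P₂ * r₂

/-- The local subsystem `{i, i+1, i+2}` is convergent at step `t`: the voltage of its controllable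
node `i + 1` no longer changes, and the sub-problems that make up the subsystem (node `i + 1` at
steps `t` and `t + 1`, and node `i + 2` at step `t`) are solved at strict local minima. -/
def LineNetwork.LocallyConvergent (N : LineNetwork) (T : Trajectory) (i t : ℕ) : Prop :=
  NodeConverged T (i + 1) t ∧
  (N.subproblem T i t).IsStrictLocalMin (T.local i t) ∧
  (N.subproblem T (i + 1) t).IsStrictLocalMin (T.local (i + 1) t) ∧
  (N.subproblem T i (t + 1)).IsStrictLocalMin (T.local i (t + 1))

/-- Preservation of convergence: if a local subsystem `{i, i+1, i+2}` that is followed by another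
one, `{i+1, i+2, i+3}`, is convergent at step `τ i`, then its controllable node `i + 1` stays
converged in the later steps. -/
def LineNetwork.PreservesConvergence (N : LineNetwork) (T : Trajectory) (τ : ℕ → ℕ) : Prop :=
  ∀ i, 1 ≤ i → i + 3 ≤ N.n → N.LocallyConvergent T i (τ i) →
    ∀ s, τ i + 1 ≤ s → NodeConverged T (i + 1) s

/-- Global convergence of the line, sequentially at the steps `τ 1 < τ 2 < ⋯ < τ (n-2)`: every
local subsystem `{i, i+1, i+2}` is convergent at step `τ i`, and the voltage of its controllable
node keeps its value at step `τ i` up to the final step `τ (n-2)`, at which all the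
controllable nodes `2, …, n-1` have converged simultaneously. -/
def LineNetwork.GloballyConvergent (N : LineNetwork) (T : Trajectory) (τ : ℕ → ℕ) : Prop :=
  (∀ i, 1 ≤ i → i + 2 ≤ N.n → N.LocallyConvergent T i (τ i)) ∧
  (∀ i, 1 ≤ i → i + 2 ≤ N.n → ∀ s, τ i ≤ s → s ≤ τ (N.n - 2) →
    T.v (i + 1) s = T.v (i + 1) (τ i)) ∧
  (∀ i, 1 ≤ i → i + 2 ≤ N.n → NodeConverged T (i + 1) (τ (N.n - 2)))

/-!
With `Δ = 1` the `Δ`-condition says exactly that the node has converged, so the content of the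
theorem is that the sub-problems are solved at strict local minima.

The four equality constraints of (P1) cut out a curve.  In the `(P, Q)`-plane it is the circle
`V (P - c) = r (P² + Q²)`, where `V` is the squared parent voltage and `c` the net active demand,
and the objective equals `P - c`.  On the half of the circle where `2 r P < V` the flow `P` is a
strictly convex function of `Q` with slope `2 r Q / (V - 2 r P)`.  At a point with `Q = 0` this is
already a strict minimum.  At a point with `Q ≠ 0` a strict local minimum can only fail if feasible
points accumulate from the side on which `|Q|` decreases; the normalized differences then converge
to a tangent direction of strict first-order descent, which stationarity excludes.  Hence a
stationary point with `2 r P < V` is a strict local minimum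
(`SubproblemData.IsStationary.isStrictLocalMin`).

It remains to verify `2 r P < V` for the three sub-problems of a subsystem.  For node `i + 1` at
step `t` it is immediate from `0 ≤ v - 8 P r`, and for node `i + 2` it follows from
`0 ≤ v - 8 P₂ r₂` because all voltages lie in `[0.95², 1.05²]`.  For node `i + 1` at step `t + 1`
the inequality `0 ≤ w³ - 4 P' r v w - 2 P₂ r₂ v - 4 P' r` bounds `P' r` once `P₂ r₂` is bounded
below, and every feasible point satisfies `-v_j ≤ 4 r P`, a sum of squares
(`SubproblemData.neg_voltage_le_of_feasible`).  That step also needs `v_i` to be the same at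
steps `t - 1` and `t`: node `i` is the source, or it has converged at an earlier `τ` and preservation
of convergence keeps its voltage fixed.  So the subsystems are treated by induction along the line.
-/

namespace SubproblemData

/-- The tangent direction of the curve cut out by the equality constraints of (P1), normalized to
have `Q`-component `1`; `m` is its `P`-component. -/
noncomputable def curveDirection (D : SubproblemData) (m : ℝ) : Fin 5 → ℝ :=
  vec m 1 (-2 * (D.r * m + D.x) + (D.r ^ 2 + D.x ^ 2) * (m / D.r)) (m / D.r)
    (D.x * (m / D.r) - 1)

/-- The slope in the `(P, Q)`-plane of the chord joining two points `y`, `z` of the curve. -/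
noncomputable def chordSlope (D : SubproblemData) (z y : Fin 5 → ℝ) : ℝ :=
  D.r * (y 1 + z 1) / (D.vPar - D.r * (y 0 + z 0))

theorem continuous_curveDirection (D : SubproblemData) : Continuous D.curveDirection := by
  unfold curveDirection vec
  refine continuous_pi fun k => ?_
  fin_cases k <;> simp <;> fun_prop

theorem continuousAt_chordSlope {D : SubproblemData} {z : Fin 5 → ℝ}
    (hP : 2 * D.r * z 0 < D.vPar) : ContinuousAt (D.chordSlope z) z := by
  unfold chordSlope
  refine ContinuousAt.div (Continuous.continuousAt (by fun_prop))
    (Continuous.continuousAt (by fun_prop)) (ne_of_gt ?_)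
  linarith

/-- The equation of the circle in the `(P, Q)`-plane, for the chord between two feasible points. -/
theorem chord_equation {D : SubproblemData} (hV : 0 < D.vPar) {z y : Fin 5 → ℝ}
    (hz : z ∈ D.feasible) (hy : y ∈ D.feasible) :
    (D.vPar - D.r * (y 0 + z 0)) * (y 0 - z 0) = D.r * (y 1 + z 1) * (y 1 - z 1) := by
  obtain ⟨h1, -, -, h4, -⟩ := hz
  obtain ⟨k1, -, -, k4, -⟩ := hy
  rw [eq_div_iff hV.ne'] at h4 k4
  linear_combination D.vPar * (k1 - h1) + D.r * (k4 - h4)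

theorem sub_eq_smul_curveDirection {D : SubproblemData} (hr : 0 < D.r) (hV : 0 < D.vPar)
    {z y : Fin 5 → ℝ} (hz : z ∈ D.feasible) (hy : y ∈ D.feasible)
    (hpos : 0 < D.vPar - D.r * (y 0 + z 0)) :
    y - z = (y 1 - z 1) • D.curveDirection (D.chordSlope z y) := by
  have hm : y 0 - z 0 = (y 1 - z 1) * D.chordSlope z y := by
    have := chord_equation hV hz hy
    unfold chordSlope
    field_simp
    linarith
  obtain ⟨h1, h2, h3, -⟩ := hz
  obtain ⟨k1, k2, k3, -⟩ := hy
  have hl : y 3 - z 3 = (y 1 - z 1) * (D.chordSlope z y / D.r) := by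
    rw [← mul_div_assoc, ← hm, eq_div_iff hr.ne']
    linarith
  funext k
  fin_cases k <;> simp [curveDirection, vec]
  · exact hm
  · rw [h3, k3]
    linear_combination -2 * D.r * hm + (D.r ^ 2 + D.x ^ 2) * hl
  · exact hl
  · linear_combination k2 - h2 + D.x * hl

/-- On the half `2 r P < V` of the feasible circle every stationary point of (P1) is a strict
local minimum. -/
theorem IsStationary.isStrictLocalMin {D : SubproblemData} {z : Fin 5 → ℝ}
    (h : D.IsStationary z) (hr : 0 < D.r) (hV : 0 < D.vPar) (hP : 2 * D.r * z 0 < D.vPar) :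
    D.IsStrictLocalMin z := by
  obtain ⟨hz, hst⟩ := h
  refine ⟨hz, ?_⟩
  by_contra hcon
  have hfreq : ∃ᶠ y in 𝓝 z, y ∈ D.feasible ∧ y ≠ z ∧ D.objective y ≤ D.objective z := by
    refine (not_eventually.mp hcon).mono fun y hy => ?_
    push Not at hy
    exact hy
  have hpos : ∀ᶠ y in 𝓝 z, 0 < D.vPar - D.r * (y 0 + z 0) := by
    have : ContinuousAt (fun y : Fin 5 → ℝ => D.vPar - D.r * (y 0 + z 0)) z :=
      Continuous.continuousAt (by fun_prop)
    exact this.eventually_const_lt (by linarith)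
  -- A competitor `y` differs from `z` in `Q`, and its `Q`-increment is a direction of descent.
  have hbad : ∀ y, y ∈ D.feasible ∧ y ≠ z ∧ D.objective y ≤ D.objective z →
      0 < D.vPar - D.r * (y 0 + z 0) →
      y 1 - z 1 ≠ 0 ∧ (y 1 + z 1) * (y 1 - z 1) ≤ 0 := by
    rintro y ⟨hy, hne, hobj⟩ hyp
    refine ⟨fun h0 => hne ?_, ?_⟩
    · have := sub_eq_smul_curveDirection hr hV hz hy hyp
      rw [h0, zero_smul] at this
      exact sub_eq_zero.mp this
    · have hle : y 0 - z 0 ≤ 0 := by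
        have h1 := hz.1
        have k1 := hy.1
        unfold objective at hobj
        linarith
      have hc := chord_equation hV hz hy
      have : D.r * ((y 1 + z 1) * (y 1 - z 1)) ≤ 0 := by
        rw [← mul_assoc, ← hc]
        exact mul_nonpos_of_nonneg_of_nonpos hyp.le hle
      exact nonpos_of_mul_nonpos_right this hr
  by_cases hQ : z 1 = 0
  · obtain ⟨y, hy, hyp⟩ := (hfreq.and_eventually hpos).exists
    obtain ⟨h0, h1⟩ := hbad y hy hyp
    rw [hQ] at h0 h1
    have := mul_self_pos.mpr h0
    simp only [add_zero, sub_zero] at h1 this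
    linarith
  · set B := {y | y ∈ D.feasible ∧ y ≠ z ∧ D.objective y ≤ D.objective z}
    have : (𝓝 z ⊓ 𝓟 B).NeBot := frequently_iff_neBot.mp hfreq
    have hl : 𝓝 z ⊓ 𝓟 B ≤ 𝓝 z := inf_le_left
    have hBmem : ∀ᶠ y in 𝓝 z ⊓ 𝓟 B, y ∈ B := mem_inf_of_right (mem_principal_self B)
    have hsame : ∀ᶠ y in 𝓝 z, 0 < z 1 * (y 1 + z 1) := by
      have : ContinuousAt (fun y : Fin 5 → ℝ => z 1 * (y 1 + z 1)) z :=
        Continuous.continuousAt (by fun_prop)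
      refine this.eventually_const_lt ?_
      have := mul_self_pos.mpr hQ
      linarith
    have hdir : -z 1 • D.curveDirection (D.chordSlope z z) ∈
        posTangentConeAt D.feasible z := by
      refine mem_tangentConeAt_of_seq (𝓝 z ⊓ 𝓟 B)
        (fun y => Real.toNNReal (-z 1 / (y 1 - z 1))) (fun y => y - z) ?_ ?_ ?_
      · have : ContinuousAt (fun y : Fin 5 → ℝ => y - z) z := by fun_prop
        have := this.tendsto
        rw [sub_self] at this
        exact this.mono_left hl
      · filter_upwards [hBmem] with y hy
        simpa using hy.1
      · have hlim : Tendsto (fun y => -z 1 • D.curveDirection (D.chordSlope z y)) (𝓝 z)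
            (𝓝 (-z 1 • D.curveDirection (D.chordSlope z z))) :=
          ((D.continuous_curveDirection.continuousAt.comp
            (continuousAt_chordSlope hP)).const_smul (-z 1)).tendsto
        refine (hlim.mono_left hl).congr' ?_
        filter_upwards [hBmem, hl hpos, hl hsame] with y hy hyp hys
        obtain ⟨h0, h1⟩ := hbad y hy hyp
        -- `z 1` has the sign of `y 1 + z 1`, so the factor `-z 1 / (y 1 - z 1)` is nonnegative.
        have hneg : z 1 * (y 1 - z 1) ≤ 0 := by
          by_contra hlt
          have := mul_pos hys (not_le.mp hlt)
          have h2 : 0 ≤ z 1 * z 1 := mul_self_nonneg _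
          nlinarith [mul_nonneg h2 (neg_nonneg.mpr h1)]
        have hc : 0 ≤ -z 1 / (y 1 - z 1) := by
          have : -z 1 / (y 1 - z 1) = -(z 1 * (y 1 - z 1)) / (y 1 - z 1) ^ 2 := by
            field_simp
          rw [this]
          exact div_nonneg (by linarith) (sq_nonneg _)
        rw [NNReal.smul_def, Real.coe_toNNReal _ hc,
          sub_eq_smul_curveDirection hr hV hz hy.1 hyp, smul_smul, div_mul_cancel₀ _ h0]
    have hobj := hst _ hdir
    have hval : D.objective (-z 1 • D.curveDirection (D.chordSlope z z)) =
        -(2 * D.r * (z 1 * z 1) / (D.vPar - D.r * (z 0 + z 0))) := by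
      simp only [objective, curveDirection, vec, chordSlope, Pi.smul_apply, smul_eq_mul]
      simp
      field_simp
      ring
    rw [hval] at hobj
    have hden : 0 < D.vPar - D.r * (z 0 + z 0) := by linarith
    have : 0 < 2 * D.r * (z 1 * z 1) / (D.vPar - D.r * (z 0 + z 0)) :=
      div_pos (mul_pos (by linarith) (mul_self_pos.mpr hQ)) hden
    linarith

/-- The voltage bound limits the reverse active flow: multiplied by the parent voltage `V`, the
quantity `v_j + 4 r P` is the sum of squares `(V + r P - x Q)² + (x P + r Q)²`. -/
theorem neg_voltage_le_of_feasible {D : SubproblemData} (hV : 0 < D.vPar) {z : Fin 5 → ℝ}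
    (hz : z ∈ D.feasible) : -z 2 ≤ 4 * (D.r * z 0) := by
  obtain ⟨-, -, h3, h4, -⟩ := hz
  rw [eq_div_iff hV.ne'] at h4
  have key : D.vPar * (z 2 + 4 * (D.r * z 0)) =
      (D.vPar + D.r * z 0 - D.x * z 1) ^ 2 + (D.x * z 0 + D.r * z 1) ^ 2 := by
    rw [h3]
    linear_combination (D.r ^ 2 + D.x ^ 2) * h4
  have : 0 ≤ z 2 + 4 * (D.r * z 0) :=
    nonneg_of_mul_nonneg_right (key ▸ by positivity) hV
  linarith

end SubproblemData

namespace LineNetwork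

variable {N : LineNetwork} {T : Trajectory}

theorem IsRun.voltage_bounds (hT : N.IsRun T) {j t : ℕ} (hj : 1 ≤ j) (hjn : j ≤ N.n)
    (ht : j = 1 ∨ 1 ≤ t) : vLow ≤ T.v j t ∧ T.v j t ≤ vHigh := by
  rcases hj.eq_or_lt with rfl | hj'
  · rw [hT.source_fixed]
    exact hT.source_bounds
  · obtain ⟨i, rfl⟩ : ∃ i, j = i + 1 := ⟨j - 1, by omega⟩
    obtain ⟨-, -, -, -, h5, h6, -⟩ := (hT.step i t (by omega) hjn (by omega)).1
    exact ⟨h5, h6⟩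

theorem IsRun.isStrictLocalMin (hT : N.IsRun T) {i t : ℕ} (hi : 1 ≤ i) (hin : i + 1 ≤ N.n)
    (ht : 1 ≤ t) (hV : 0 < T.v i (t - 1)) (hP : 2 * (T.P i t * N.r i) < T.v i (t - 1)) :
    (N.subproblem T i t).IsStrictLocalMin (T.local i t) := by
  refine (hT.step i t hi hin ht).isStrictLocalMin (N.r_pos i hi hin) hV ?_
  change 2 * N.r i * T.P i t < T.v i (t - 1)
  linarith

theorem IsRun.neg_voltage_le (hT : N.IsRun T) {i t : ℕ} (hi : 1 ≤ i) (hin : i + 1 ≤ N.n)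
    (ht : 1 ≤ t) (hV : 0 < T.v i (t - 1)) : -T.v (i + 1) t ≤ 4 * (T.P i t * N.r i) := by
  have h := SubproblemData.neg_voltage_le_of_feasible (D := N.subproblem T i t) hV
    (hT.step i t hi hin ht).1
  change -T.v (i + 1) t ≤ 4 * (N.r i * T.P i t) at h
  linarith

/-- A subsystem whose controllable node has converged is convergent, provided the voltage of its
parent node is the one of the previous step. -/
theorem IsRun.locallyConvergent (hT : N.IsRun T) {i t : ℕ} (hi : 1 ≤ i) (hin : i + 2 ≤ N.n)
    (ht : 1 ≤ t) (hit : i = 1 ∨ 2 ≤ t) (hpar : T.v i t = T.v i (t - 1))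
    (hconv : NodeConverged T (i + 1) t) (hineq : N.SubsystemInequalities T i t) :
    N.LocallyConvergent T i t := by
  obtain ⟨-, -, -, -, -, -, -, -, h9, h10, -, h12⟩ := hineq
  obtain ⟨hv₁, hv₂⟩ := hT.voltage_bounds (j := i) (t := t - 1) hi (by omega) (by omega)
  have hw := hT.voltage_bounds (j := i + 1) (t := t) (by omega) (by omega) (Or.inr ht)
  rw [hconv] at hw
  obtain ⟨hw₁, hw₂⟩ := hw
  obtain ⟨-, hu⟩ := hT.voltage_bounds (j := i + 1 + 1) (t := t) (by omega) (by omega) (Or.inr ht)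
  unfold vLow at hv₁ hw₁
  unfold vHigh at hv₂ hw₂ hu
  norm_num at hv₁ hw₁ hv₂ hw₂ hu
  have hrev := hT.neg_voltage_le (i := i + 1) (t := t) (by omega) (by omega) ht (by linarith)
  refine ⟨hconv, ?_, ?_, ?_⟩
  · exact hT.isStrictLocalMin hi (by omega) ht (by linarith) (by linarith)
  · exact hT.isStrictLocalMin (by omega) (by omega) ht (by linarith) (by linarith)
  · have hsub : t + 1 - 1 = t := by omega
    refine hT.isStrictLocalMin hi (by omega) (by omega) ?_ ?_
    · rw [hsub, hpar]
      linarith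
    · rw [hsub, hpar]
      generalize T.v i (t - 1) = v at *
      generalize T.v (i + 1) (t - 1) = w at *
      generalize hA : T.P i (t + 1) * N.r i = A at *
      generalize hB : T.P (i + 1) t * N.r (i + 1) = B at *
      have h9' : 4 * A * (v * w + 1) ≤ w ^ 3 - 2 * B * v := by
        rw [← hA, ← hB]
        linarith
      -- `0.55125 = 1.05² / 2`, from `-u ≤ 4 B` for the voltage `u ≤ 1.05²` of node `i + 2`
      have hBv : -2 * B * v ≤ 0.55125 * v := by nlinarith
      -- `w (2 v² - w²)` is positive because `w² ≤ 1.05⁴ < 2 · 0.95⁴ ≤ 2 v²`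
      have hvw : w ^ 3 + 0.55125 * v < 2 * v * (v * w + 1) := by
        have hv2 : 0.81 ≤ v ^ 2 := by nlinarith
        have hw2 : w ^ 2 ≤ 1.22 := by nlinarith
        have : 0 ≤ w * (2 * v ^ 2 - w ^ 2) := mul_nonneg (by linarith) (by linarith)
        nlinarith
      have hpos : 0 < v * w + 1 := by nlinarith
      by_contra hle
      have := mul_le_mul_of_nonneg_right (not_lt.mp hle) hpos.le
      linarith

end LineNetwork

theorem theorem3 (N : LineNetwork) (hn : 4 ≤ N.n) (T : Trajectory) (hT : N.IsRun T)
    (τ : ℕ → ℕ) (hτ₁ : 1 ≤ τ 1)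
    (hτ : ∀ i, 1 ≤ i → i + 3 ≤ N.n → τ i + 1 ≤ τ (i + 1))
    (hpres : N.PreservesConvergence T τ)
    (hΔ : ∀ i, 1 ≤ i → i + 2 ≤ N.n → DeltaCondition T 1 (i + 1) (τ i))
    (hineq : ∀ i, 1 ≤ i → i + 2 ≤ N.n → N.SubsystemInequalities T i (τ i)) :
    N.GloballyConvergent T τ := by
  have hconv : ∀ i, 1 ≤ i → i + 2 ≤ N.n → NodeConverged T (i + 1) (τ i) := by
    intro i hi hin
    obtain ⟨h1, h2⟩ := hΔ i hi hin
    simp only [div_one, one_mul] at h1 h2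
    exact le_antisymm h2 h1
  have hτi : ∀ i, 1 ≤ i → i + 2 ≤ N.n → i ≤ τ i := by
    intro i hi
    induction i, hi using Nat.le_induction with
    | base => exact fun _ => hτ₁
    | succ i hi ih =>
      intro hin
      have := ih (by omega)
      have := hτ i hi (by omega)
      omega
  have hloc : ∀ i, 1 ≤ i → i + 2 ≤ N.n → N.LocallyConvergent T i (τ i) := by
    intro i hi
    induction i, hi using Nat.le_induction with
    | base =>
      intro hin
      exact hT.locallyConvergent le_rfl hin hτ₁ (Or.inl rfl)
        ((hT.source_fixed _).trans (hT.source_fixed _).symm) (hconv 1 le_rfl hin)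
        (hineq 1 le_rfl hin)
    | succ i hi ih =>
      intro hin
      have h := hτi (i + 1) (by omega) hin
      exact hT.locallyConvergent (by omega) hin (by omega) (Or.inr (by omega))
        (hpres i hi (by omega) (ih (by omega)) _ (hτ i hi (by omega)))
        (hconv (i + 1) (by omega) hin) (hineq (i + 1) (by omega) hin)
  refine ⟨hloc, ?_, ?_⟩
  · intro i hi hin s hs
    induction s, hs using Nat.le_induction with
    | base => exact fun _ => rfl
    | succ s hs ih =>
      intro hsn
      -- for `i = n - 2` there is no step beyond `τ i`
      have hin' : i + 3 ≤ N.n := by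
        by_contra hcon
        obtain rfl : i = N.n - 2 := by omega
        omega
      have h := hpres i hi hin' (hloc i hi hin) (s + 1) (by omega)
      exact h.trans (ih (by omega))
  · intro i hi hin
    rcases Nat.lt_or_ge N.n (i + 3) with h | h
    · obtain rfl : i = N.n - 2 := by omega
      exact hconv _ hi hin
    · have hmono : ∀ k, i + 1 ≤ k → k + 2 ≤ N.n → τ i + 1 ≤ τ k := by
        intro k hk
        induction k, hk using Nat.le_induction with
        | base => exact fun _ => hτ i hi h
        | succ k hk ih =>
          intro hkn
          have := ih (by omega)
          have := hτ k (by omega) (by omega)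
          omega
      exact hpres i hi h (hloc i hi hin) _ (hmono _ (by omega) (by omega))
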